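/- Let $N\in\mathbb{N}$ and $p\in(1,\infty)$. For a non-empty open set $\Omega\subset\mathbb{R}^N$ let $W^{1,p}(\Omega)$ be the Sobolev space of all $u\in L^p(\Omega)$ whose distributional first order partial derivatives belong to $L^p(\Omega)$, with norm given by \[ \|u\|_{W^{1,p}(\Omega)}^p=\|u\|_{L^p(\Omega)}^p+\sum_{i=1}^N\|\partial_i u\|_{L^p(\Omega)}^p, \] and let $\tilde W^{1,p}(\Omega)$ be the closure in $W^{1,p}(\Omega)$ of $\{u|_\Omega : u\in C_c(\overline\Omega),\ u|_\Omega\in W^{1,p}(\Omega)\}$, where $C_c(\overline\Omega)$ is the space of real-valued continuous functions with compact support on $\overline\Omega$. For $A\subset\overline\Omega$ the relative $p$-capacity of $A$ is \[ \mathrm{Cap}_{p,\Omega}(A)=\inf\{\|u\|_{W^{1,p}(\Omega)}^p : u\in\tilde W^{1,p}(\Omega),\ u\ge 1 \text{ a.e. on } O\cap\Omega \text{ for some } O\supset A \text{ open in } \overline\Omega\}\in[0,\infty]. \] Let $U\subset V\subset\mathbb{R}^N$ be non-empty open sets. Then for every $A\subset U$, \[ \mathrm{Cap}_{p,U}(A)=0\iff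 \mathrm{Cap}_{p,V}(A)=0. \] Consequently, whether a set is polar does not depend on the ambient open set containing it: if $U,V\subset\mathbb{R}^N$ are arbitrary non-empty open sets and $A\subset U\cap V$, then $\mathrm{Cap}_{p,U}(A)=0$ if and only if $\mathrm{Cap}_{p,V}(A)=0$. -/

import Mathlib

open MeasureTheory
open scoped ENNReal ContDiff

noncomputable section

namespace RelCap

/-- `g` is the weak partial derivative `∂ᵢ u` (derivative in the sense of distributions) on `Ω`.
Only the values of `u` and `g` on `Ω` matter. -/
def IsWeakPartial {N : ℕ} (Ω : Set (EuclideanSpace ℝ (Fin N))) (i : Fin N)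
    (u g : EuclideanSpace ℝ (Fin N) → ℝ) : Prop :=
  LocallyIntegrableOn u Ω ∧ LocallyIntegrableOn g Ω ∧
    ∀ φ : EuclideanSpace ℝ (Fin N) → ℝ, ContDiff ℝ ∞ φ → HasCompactSupport φ → tsupport φ ⊆ Ω →
      ∫ x in Ω, u x * fderiv ℝ φ x (EuclideanSpace.single i 1) = -∫ x in Ω, g x * φ x

/-- `u` represents an element of the Sobolev space `W^{1,p}(Ω)`. -/
def MemW {N : ℕ} (p : ℝ) (Ω : Set (EuclideanSpace ℝ (Fin N)))
    (u : EuclideanSpace ℝ (Fin N) → ℝ) : Prop :=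
  MemLp u (ENNReal.ofReal p) (volume.restrict Ω) ∧
    ∀ i, ∃ g, IsWeakPartial Ω i u g ∧ MemLp g (ENNReal.ofReal p) (volume.restrict Ω)

open Classical in
/-- The weak partial derivative `∂ᵢ u` on `Ω`, where it exists (for open `Ω` it is unique up to
equality almost everywhere on `Ω`); zero otherwise. -/
def weakPartial {N : ℕ} (Ω : Set (EuclideanSpace ℝ (Fin N))) (i : Fin N)
    (u : EuclideanSpace ℝ (Fin N) → ℝ) : EuclideanSpace ℝ (Fin N) → ℝ :=
  if h : ∃ g, IsWeakPartial Ω i u g then h.choose else 0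

/-- The `p`-th power of the norm of `W^{1,p}(Ω)`, for `u` in that space:
`‖u‖_{L^p(Ω)}^p + ∑ᵢ ‖∂ᵢ u‖_{L^p(Ω)}^p`. -/
def normPow {N : ℕ} (p : ℝ) (Ω : Set (EuclideanSpace ℝ (Fin N)))
    (u : EuclideanSpace ℝ (Fin N) → ℝ) : ℝ≥0∞ :=
  eLpNorm u (ENNReal.ofReal p) (volume.restrict Ω) ^ p +
    ∑ i, eLpNorm (weakPartial Ω i u) (ENNReal.ofReal p) (volume.restrict Ω) ^ p

/-- The restriction of `w` to the closure of `Ω` belongs to `C_c(closure Ω)`. -/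
def MemCc {N : ℕ} (Ω : Set (EuclideanSpace ℝ (Fin N)))
    (w : EuclideanSpace ℝ (Fin N) → ℝ) : Prop :=
  ContinuousOn w (closure Ω) ∧
    ∃ K, IsCompact K ∧ K ⊆ closure Ω ∧ ∀ x ∈ closure Ω \ K, w x = 0

/-- `u` represents an element of the closure of `W^{1,p}(Ω) ∩ C_c(closure Ω)` in `W^{1,p}(Ω)`. -/
def MemWTilde {N : ℕ} (p : ℝ) (Ω : Set (EuclideanSpace ℝ (Fin N)))
    (u : EuclideanSpace ℝ (Fin N) → ℝ) : Prop :=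
  MemW p Ω u ∧ ∀ ε : ℝ≥0∞, 0 < ε →
    ∃ w, MemCc Ω w ∧ MemW p Ω w ∧ normPow p Ω (fun x => u x - w x) < ε

/-- `u` is admissible for `A ⊆ closure Ω`: `u ∈ W̃^{1,p}(Ω)` and `u ≥ 1` almost everywhere on
`O ∩ Ω`, for some relatively open `O = G ∩ closure Ω` containing `A`. -/
def Admissible {N : ℕ} (p : ℝ) (Ω A : Set (EuclideanSpace ℝ (Fin N)))
    (u : EuclideanSpace ℝ (Fin N) → ℝ) : Prop :=
  MemWTilde p Ω u ∧
    ∃ G, IsOpen G ∧ A ⊆ G ∩ closure Ω ∧ ∀ᵐ x ∂volume.restrict (G ∩ Ω), 1 ≤ u x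

/-- The relative `p`-capacity of `A ⊆ closure Ω` with respect to `Ω` (`∞` if there is no
admissible function). -/
def relCap {N : ℕ} (p : ℝ) (Ω A : Set (EuclideanSpace ℝ (Fin N))) : ℝ≥0∞ :=
  ⨅ (u : EuclideanSpace ℝ (Fin N) → ℝ) (_ : Admissible p Ω A u), normPow p Ω u

end RelCap

end

/-!
Let `ψ₀, ψ₁, …` be a partition of unity on `U` by nonnegative test functions, locally a finite
sum. Multiplication by `ψₙ` maps `W̃^{1,p}(U)` boundedly into `W̃^{1,p}(V)` for every open set `V`.
If `A` has capacity zero in `U`, choose `uₙ` admissible for `A` in `U` with norm so small that the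
norms of `uₙ ψₙ` in `W^{1,p}(V)` have a sum below `ε`. By completeness `w = ∑ uₙ ψₙ` lies in
`W̃^{1,p}(V)`, with norm below `ε`. Around each point of `A` only finitely many terms are nonzero,
so all the corresponding `uₙ` are at least `1` on a common neighbourhood, where `w ≥ ∑ ψₙ = 1`.
The construction is symmetric in `U` and `V`, which gives both implications.
-/

noncomputable section

namespace RelCap

section TestFunctions

variable {E : Type*} [NormedAddCommGroup E] [NormedSpace ℝ E] {Ω : Set E} {φ ψ u : E → ℝ}

/-- Real-valued test functions on `Ω`, extended by zero to the whole space: smooth functions whose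
support is compact and contained in `Ω`. -/
structure IsTestFunction (Ω : Set E) (φ : E → ℝ) : Prop where
  contDiff : ContDiff ℝ ∞ φ
  hasCompactSupport : HasCompactSupport φ
  tsupport_subset : tsupport φ ⊆ Ω

namespace IsTestFunction

lemma continuous (hφ : IsTestFunction Ω φ) : Continuous φ :=
  hφ.contDiff.continuous

lemma eq_zero_of_notMem (hφ : IsTestFunction Ω φ) {x : E} (hx : x ∉ Ω) : φ x = 0 :=
  image_eq_zero_of_notMem_tsupport fun h => hx (hφ.tsupport_subset h)

lemma mul_contDiff (hφ : IsTestFunction Ω φ) (hψ : ContDiff ℝ ∞ ψ) :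
    IsTestFunction Ω fun x => φ x * ψ x where
  contDiff := hφ.contDiff.mul hψ
  hasCompactSupport := hφ.hasCompactSupport.mul_right
  tsupport_subset := tsupport_mul_subset_left.trans hφ.tsupport_subset

lemma fderiv_apply (hφ : IsTestFunction Ω φ) (v : E) :
    IsTestFunction Ω fun x => fderiv ℝ φ x v where
  contDiff := (hφ.contDiff.fderiv_right (by simp)).clm_apply contDiff_const
  hasCompactSupport := hφ.hasCompactSupport.fderiv_apply ℝ v
  tsupport_subset := (tsupport_fderiv_apply_subset ℝ v).trans hφ.tsupport_subset

lemma exists_norm_le (hφ : IsTestFunction Ω φ) : ∃ C, ∀ x, ‖φ x‖ ≤ C :=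
  hφ.hasCompactSupport.exists_bound_of_continuous hφ.continuous

lemma indicator_mul (hφ : IsTestFunction Ω φ) :
    Ω.indicator (fun x => u x * φ x) = fun x => u x * φ x :=
  Set.indicator_eq_self.2 <| Function.support_subset_iff'.2 fun x hx => by
    rw [hφ.eq_zero_of_notMem hx, mul_zero]

variable [MeasurableSpace E] {μ : Measure E} {q : ℝ≥0∞}

lemma setIntegral_mul (hφ : IsTestFunction Ω φ) :
    ∫ x in Ω, u x * φ x ∂μ = ∫ x, u x * φ x ∂μ :=
  setIntegral_eq_integral_of_forall_compl_eq_zero fun x hx => by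
    rw [hφ.eq_zero_of_notMem hx, mul_zero]

lemma eLpNorm_mul_le (hφ : IsTestFunction Ω φ) (hΩ : MeasurableSet Ω) {C : ℝ}
    (hC : ∀ x, ‖φ x‖ ≤ C) :
    eLpNorm (fun x => u x * φ x) q μ ≤ ENNReal.ofReal C * eLpNorm u q (μ.restrict Ω) := by
  rw [← hφ.indicator_mul, eLpNorm_indicator_eq_eLpNorm_restrict hΩ]
  refine eLpNorm_le_mul_eLpNorm_of_ae_le_mul (ae_of_all _ fun x => ?_) q
  rw [norm_mul, mul_comm]
  gcongr
  exact hC x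

variable [BorelSpace E]

lemma memLp [IsFiniteMeasureOnCompacts μ] (hφ : IsTestFunction Ω φ) : MemLp φ q μ :=
  hφ.continuous.memLp_of_hasCompactSupport hφ.hasCompactSupport

lemma memLp_mul (hφ : IsTestFunction Ω φ) (hΩ : MeasurableSet Ω)
    (hu : MemLp u q (μ.restrict Ω)) : MemLp (fun x => u x * φ x) q μ := by
  obtain ⟨C, hC⟩ := hφ.exists_norm_le
  refine ⟨?_, (hφ.eLpNorm_mul_le hΩ hC).trans_lt (ENNReal.mul_lt_top ENNReal.ofReal_lt_top hu.2)⟩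
  rw [← hφ.indicator_mul, aestronglyMeasurable_indicator_iff hΩ]
  exact hu.1.mul hφ.continuous.aestronglyMeasurable

lemma integrable_mul (hφ : IsTestFunction Ω φ) (hu : LocallyIntegrableOn u Ω μ) :
    Integrable (fun x => u x * φ x) μ := by
  have hzero : ∀ x ∉ tsupport φ, u x * φ x = 0 := fun x hx => by
    rw [image_eq_zero_of_notMem_tsupport hx, mul_zero]
  rw [← integrableOn_iff_integrable_of_support_subset
    (Function.support_subset_iff'.2 hzero)]
  exact (hu.integrableOn_compact_subset hφ.tsupport_subset hφ.hasCompactSupport).mul_continuousOn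
    hφ.continuous.continuousOn hφ.hasCompactSupport

end IsTestFunction

end TestFunctions

section PartitionOfUnity

open Filter Topology

lemma hasSum_mul_prod_one_sub {R : Type*} [CommRing R] [TopologicalSpace R] {f : ℕ → R} {m : ℕ}
    (hm : f m = 1) : HasSum (fun n => f n * ∏ k ∈ Finset.range n, (1 - f k)) 1 := by
  have hvanish (n : ℕ) (hn : m < n) : ∏ k ∈ Finset.range n, (1 - f k) = 0 :=
    Finset.prod_eq_zero (Finset.mem_range.2 hn) (by rw [hm, sub_self])
  have htelescope (n : ℕ) : ∑ k ∈ Finset.range n, f k * ∏ j ∈ Finset.range k, (1 - f j) =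
      1 - ∏ k ∈ Finset.range n, (1 - f k) := by
    induction n with
    | zero => simp
    | succ n ih => rw [Finset.sum_range_succ, ih, Finset.prod_range_succ]; ring
  have hsum : HasSum (fun n => f n * ∏ k ∈ Finset.range n, (1 - f k))
      (∑ k ∈ Finset.range (m + 1), f k * ∏ j ∈ Finset.range k, (1 - f j)) :=
    hasSum_sum_of_ne_finset_zero fun n hn => by
      rw [hvanish n (by simpa using hn), mul_zero]
  rwa [htelescope, hvanish (m + 1) m.lt_succ_self, sub_zero] at hsum

variable {E : Type*} [NormedAddCommGroup E] [NormedSpace ℝ E] [FiniteDimensional ℝ E]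
  {K Ω : Set E}

lemma exists_isTestFunction_eq_one (hK : IsCompact K) (hΩ : IsOpen Ω) (hKΩ : K ⊆ Ω) :
    ∃ η : E → ℝ, IsTestFunction Ω η ∧ (∀ x, η x ∈ Set.Icc 0 1) ∧ ∀ᶠ x in 𝓝ˢ K, η x = 1 := by
  obtain ⟨L, hL, hKL, hLΩ⟩ := exists_compact_between hK hΩ hKΩ
  obtain ⟨η, hone, hzero, hmem⟩ := exists_contMDiffMap_one_nhds_of_subset_interior
    (n := ⊤) (modelWithCornersSelf ℝ E) hK.isClosed hKL
  have hsupp : tsupport η ⊆ L :=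
    closure_minimal (Function.support_subset_iff'.2 hzero) hL.isClosed
  exact ⟨η, ⟨η.contMDiff.contDiff, hL.of_isClosed_subset (isClosed_tsupport _) hsupp,
    hsupp.trans hLΩ⟩, hmem, hone⟩

lemma exists_isTestFunction_hasSum_one (hΩ : IsOpen Ω) :
    ∃ ψ : ℕ → E → ℝ, (∀ n, IsTestFunction Ω (ψ n)) ∧ (∀ n x, 0 ≤ ψ n x) ∧
      ∀ x ∈ Ω, HasSum (fun n => ψ n x) 1 ∧ ∃ m, ∀ᶠ y in 𝓝 x, ∀ n > m, ψ n y = 0 := by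
  have : LocallyCompactSpace Ω := hΩ.locallyCompactSpace
  obtain ⟨K, hK, hKΩ⟩ : IsSigmaCompact Ω := isSigmaCompact_iff_sigmaCompactSpace.2 inferInstance
  choose η hη hmem hone using fun n =>
    exists_isTestFunction_eq_one (hK n) hΩ ((Set.subset_iUnion K n).trans_eq hKΩ)
  refine ⟨fun n x => η n x * ∏ k ∈ Finset.range n, (1 - η k x), fun n => ?_, fun n x => ?_,
    fun x hx => ?_⟩
  · exact (hη n).mul_contDiff (contDiff_prod fun k _ => contDiff_const.sub (hη k).contDiff)
  · exact mul_nonneg (hmem n x).1 (Finset.prod_nonneg fun k _ => sub_nonneg.2 (hmem k x).2)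
  · obtain ⟨m, hm⟩ := Set.mem_iUnion.1 (hKΩ.symm ▸ hx)
    have hnear : ∀ᶠ y in 𝓝 x, η m y = 1 := (hone m).filter_mono (nhds_le_nhdsSet hm)
    refine ⟨hasSum_mul_prod_one_sub hnear.self_of_nhds, m, hnear.mono fun y hy n hn => ?_⟩
    exact mul_eq_zero_of_right _ <|
      Finset.prod_eq_zero (Finset.mem_range.2 hn) (by rw [hy, sub_self])

end PartitionOfUnity

section WeakPartial

variable {N : ℕ} {Ω U V : Set (EuclideanSpace ℝ (Fin N))} {i : Fin N}
  {u v g h η : EuclideanSpace ℝ (Fin N) → ℝ}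

lemma isWeakPartial_iff :
    IsWeakPartial Ω i u g ↔ LocallyIntegrableOn u Ω ∧ LocallyIntegrableOn g Ω ∧
      ∀ φ, IsTestFunction Ω φ →
        ∫ x, u x * fderiv ℝ φ x (EuclideanSpace.single i 1) = -∫ x, g x * φ x := by
  refine and_congr_right' <| and_congr_right' ⟨fun hibp φ hφ => ?_, fun hibp φ hsmooth hc hs => ?_⟩
  · rw [← hφ.setIntegral_mul, ← (hφ.fderiv_apply _).setIntegral_mul]
    exact hibp φ hφ.1 hφ.2 hφ.3
  · have hφ : IsTestFunction Ω φ := ⟨hsmooth, hc, hs⟩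
    rw [hφ.setIntegral_mul, (hφ.fderiv_apply _).setIntegral_mul]
    exact hibp φ hφ

namespace IsWeakPartial

lemma congr (hu : IsWeakPartial Ω i u g) (huv : u =ᵐ[volume.restrict Ω] v)
    (hgh : g =ᵐ[volume.restrict Ω] h) : IsWeakPartial Ω i v h :=
  ⟨hu.1.congr huv, hu.2.1.congr hgh, fun φ hsmooth hc hs =>
    (integral_congr_ae (huv.symm.mul .rfl)).trans <|
      (hu.2.2 φ hsmooth hc hs).trans (congrArg _ (integral_congr_ae (hgh.mul .rfl)))⟩

lemma ae_eq (hΩ : IsOpen Ω) (hg : IsWeakPartial Ω i u g) (hh : IsWeakPartial Ω i u h) :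
    g =ᵐ[volume.restrict Ω] h := by
  obtain ⟨-, hgloc, hgibp⟩ := isWeakPartial_iff.1 hg
  obtain ⟨-, hhloc, hhibp⟩ := isWeakPartial_iff.1 hh
  have hzero := hΩ.ae_eq_zero_of_integral_contDiff_smul_eq_zero (hgloc.sub hhloc)
    fun φ hsmooth hc hs => by
      have hφ : IsTestFunction Ω φ := ⟨hsmooth, hc, hs⟩
      simp only [Pi.sub_apply, smul_eq_mul, mul_comm (φ _), sub_mul]
      rw [integral_sub (hφ.integrable_mul hgloc) (hφ.integrable_mul hhloc), sub_eq_zero]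
      exact neg_injective ((hgibp φ hφ).symm.trans (hhibp φ hφ))
  rw [Filter.EventuallyEq, ae_restrict_iff' hΩ.measurableSet]
  filter_upwards [hzero] with x hx hxΩ using sub_eq_zero.1 (hx hxΩ)

lemma weakPartial_ae_eq (hΩ : IsOpen Ω) (hg : IsWeakPartial Ω i u g) :
    weakPartial Ω i u =ᵐ[volume.restrict Ω] g := by
  have hex : ∃ g, IsWeakPartial Ω i u g := ⟨g, hg⟩
  rw [weakPartial, dif_pos hex]
  exact hex.choose_spec.ae_eq hΩ hg

lemma mul_testFunction (hu : IsWeakPartial U i u g) (hη : IsTestFunction U η) :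
    IsWeakPartial V i (fun x => u x * η x)
      (fun x => g x * η x + u x * fderiv ℝ η x (EuclideanSpace.single i 1)) := by
  obtain ⟨huloc, hgloc, hibp⟩ := isWeakPartial_iff.1 hu
  have hη' := hη.fderiv_apply (EuclideanSpace.single i 1)
  refine isWeakPartial_iff.2 ⟨(hη.integrable_mul huloc).locallyIntegrable.locallyIntegrableOn V,
    ((hη.integrable_mul hgloc).add
      (hη'.integrable_mul huloc)).locallyIntegrable.locallyIntegrableOn V, fun φ hφ => ?_⟩
  have hφ' := hφ.fderiv_apply (EuclideanSpace.single i 1)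
  have hleibniz (x) : fderiv ℝ (fun x => η x * φ x) x (EuclideanSpace.single i 1) =
      η x * fderiv ℝ φ x (EuclideanSpace.single i 1) +
        fderiv ℝ η x (EuclideanSpace.single i 1) * φ x := by
    rw [fderiv_fun_mul (hη.contDiff.differentiable (by simp) x)
      (hφ.contDiff.differentiable (by simp) x)]
    simp [mul_comm]
  have hibp_mul := hibp _ (hη.mul_contDiff hφ.contDiff)
  simp only [hleibniz, mul_add] at hibp_mul
  rw [integral_add ((hη.mul_contDiff hφ'.contDiff).integrable_mul huloc)
    ((hη'.mul_contDiff hφ.contDiff).integrable_mul huloc)] at hibp_mul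
  simp only [add_mul, mul_assoc]
  rw [integral_add ((hη.mul_contDiff hφ.contDiff).integrable_mul hgloc)
    ((hη'.mul_contDiff hφ.contDiff).integrable_mul huloc)]
  linarith

end IsWeakPartial

end WeakPartial

section IntegralMul

variable {α : Type*} [MeasurableSpace α] {μ : Measure α} {q : ℝ≥0∞} [Fact (1 ≤ q)] {φ : α → ℝ}

/-- The continuous linear functional `f ↦ ∫ f φ` on `L^q`, for `φ` in the dual Lebesgue space. -/
def integralMul (q : ℝ≥0∞) [Fact (1 ≤ q)] (hφ : MemLp φ q.conjExponent μ) : Lp ℝ q μ →L[ℝ] ℝ :=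
  haveI := ENNReal.HolderConjugate.conjExponent (Fact.out : 1 ≤ q)
  haveI : Fact (1 ≤ q.conjExponent) := ⟨ENNReal.HolderConjugate.one_le _ q⟩
  ((ContinuousLinearMap.mul ℝ ℝ).lpPairing μ q q.conjExponent).flip (hφ.toLp φ)

lemma integralMul_apply (hφ : MemLp φ q.conjExponent μ) (f : Lp ℝ q μ) :
    integralMul q hφ f = ∫ x, f x * φ x ∂μ := by
  have := ENNReal.HolderConjugate.conjExponent (Fact.out : 1 ≤ q)
  have : Fact (1 ≤ q.conjExponent) := ⟨ENNReal.HolderConjugate.one_le _ q⟩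
  rw [integralMul, ContinuousLinearMap.flip_apply, ContinuousLinearMap.lpPairing_eq_integral]
  refine integral_congr_ae ?_
  filter_upwards [hφ.coeFn_toLp] with x hx
  rw [hx, ContinuousLinearMap.mul_apply']

end IntegralMul

section Jet

variable {N : ℕ} {q : ℝ≥0∞} [Fact (1 ≤ q)] {Ω : Set (EuclideanSpace ℝ (Fin N))}
  {u w : EuclideanSpace ℝ (Fin N) → ℝ}

/-- Tuples `(u, g₁, …, g_N)` of elements of `L^q(Ω)` with the `ℓ^q` norm: the component at `none` is
`u`, the component at `some i` is a candidate for `∂ᵢ u`. -/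
abbrev Jet (q : ℝ≥0∞) (Ω : Set (EuclideanSpace ℝ (Fin N))) : Type :=
  PiLp q fun _ : Option (Fin N) => Lp ℝ q (volume.restrict Ω)

/-- The Sobolev space `W^{1,q}(Ω)`, each function being recorded together with its weak partial
derivatives. Cutting it out by continuous linear functionals makes it a closed subspace. -/
def sobolev (q : ℝ≥0∞) [Fact (1 ≤ q)] (Ω : Set (EuclideanSpace ℝ (Fin N))) :
    Submodule ℝ (Jet q Ω) :=
  ⨅ (i : Fin N) (φ : EuclideanSpace ℝ (Fin N) → ℝ) (hφ : IsTestFunction Ω φ),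
    LinearMap.ker
      (integralMul q (hφ.fderiv_apply (EuclideanSpace.single i 1)).memLp ∘L PiLp.proj q _ none +
        integralMul q hφ.memLp ∘L PiLp.proj q _ (some i) : Jet q Ω →L[ℝ] ℝ).toLinearMap

lemma locallyIntegrableOn_coeFn (f : Lp ℝ q (volume.restrict Ω)) : LocallyIntegrableOn f Ω :=
  locallyIntegrableOn_of_locallyIntegrable_restrict ((Lp.memLp f).locallyIntegrable Fact.out)

lemma mem_sobolev {x : Jet q Ω} :
    x ∈ sobolev q Ω ↔ ∀ i, IsWeakPartial Ω i (x none) (x (some i)) := by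
  simp only [sobolev, Submodule.mem_iInf, LinearMap.mem_ker, ContinuousLinearMap.coe_coe,
    add_apply, ContinuousLinearMap.comp_apply, PiLp.proj_apply,
    integralMul_apply, add_eq_zero_iff_eq_neg]
  exact forall_congr' fun i =>
    ⟨fun h => ⟨locallyIntegrableOn_coeFn _, locallyIntegrableOn_coeFn _,
      fun φ hsmooth hc hs => h φ ⟨hsmooth, hc, hs⟩⟩, fun h φ hφ => h.2.2 φ hφ.1 hφ.2 hφ.3⟩

lemma isClosed_sobolev : IsClosed (sobolev q Ω : Set (Jet q Ω)) := by
  simp only [sobolev, Submodule.coe_iInf]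
  exact isClosed_iInter fun i => isClosed_iInter fun φ => isClosed_iInter fun hφ =>
    ContinuousLinearMap.isClosed_ker _

lemma MemCc.add (hu : MemCc Ω u) (hw : MemCc Ω w) : MemCc Ω (u + w) := by
  obtain ⟨hucont, K, hK, hKΩ, huK⟩ := hu
  obtain ⟨hwcont, L, hL, hLΩ, hwL⟩ := hw
  refine ⟨hucont.add hwcont, K ∪ L, hK.union hL, Set.union_subset hKΩ hLΩ, fun x hx => ?_⟩
  rw [Pi.add_apply, huK x ⟨hx.1, fun h => hx.2 (.inl h)⟩, hwL x ⟨hx.1, fun h => hx.2 (.inr h)⟩,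
    add_zero]

lemma MemCc.const_smul (c : ℝ) (hu : MemCc Ω u) : MemCc Ω (c • u) := by
  obtain ⟨hcont, K, hK, hKΩ, huK⟩ := hu
  exact ⟨hcont.const_smul c, K, hK, hKΩ, fun x hx => by rw [Pi.smul_apply, huK x hx, smul_zero]⟩

/-- The space `W^{1,q}(Ω) ∩ C_c(closure Ω)`. -/
def ccSobolev (q : ℝ≥0∞) [Fact (1 ≤ q)] (Ω : Set (EuclideanSpace ℝ (Fin N))) :
    Submodule ℝ (Jet q Ω) where
  carrier := {x | x ∈ sobolev q Ω ∧ ∃ w, MemCc Ω w ∧ x none =ᵐ[volume.restrict Ω] w}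
  zero_mem' := ⟨zero_mem _, 0, ⟨continuousOn_const, ∅, isCompact_empty, Set.empty_subset _,
    fun _ _ => rfl⟩, Lp.coeFn_zero _ _ _⟩
  add_mem' := by
    rintro x y ⟨hx, u, hu, hxu⟩ ⟨hy, w, hw, hyw⟩
    exact ⟨add_mem hx hy, u + w, hu.add hw, (Lp.coeFn_add _ _).trans (hxu.add hyw)⟩
  smul_mem' := by
    rintro c x ⟨hx, u, hu, hxu⟩
    exact ⟨Submodule.smul_mem _ c hx, c • u, hu.const_smul c,
      (Lp.coeFn_smul _ _).trans (hxu.const_smul c)⟩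

/-- The space `W̃^{1,q}(Ω)`. -/
def sobolevTilde (q : ℝ≥0∞) [Fact (1 ≤ q)] (Ω : Set (EuclideanSpace ℝ (Fin N))) :
    Submodule ℝ (Jet q Ω) :=
  (ccSobolev q Ω).topologicalClosure

lemma sobolevTilde_le_sobolev : sobolevTilde q Ω ≤ sobolev q Ω :=
  Submodule.topologicalClosure_minimal _ (fun _ hx => hx.1) isClosed_sobolev

lemma isClosed_sobolevTilde : IsClosed (sobolevTilde q Ω : Set (Jet q Ω)) :=
  Submodule.isClosed_topologicalClosure _

lemma IsWeakPartial.of_mem_sobolev {x : Jet q Ω} (hx : x ∈ sobolev q Ω)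
    (hxu : x none =ᵐ[volume.restrict Ω] u) (i : Fin N) : IsWeakPartial Ω i u (x (some i)) :=
  (mem_sobolev.1 hx i).congr hxu .rfl

end Jet

section MemW

variable {N : ℕ} {p : ℝ} [Fact (1 ≤ ENNReal.ofReal p)] {Ω : Set (EuclideanSpace ℝ (Fin N))}
  {u w : EuclideanSpace ℝ (Fin N) → ℝ}

lemma memW_iff :
    MemW p Ω u ↔ ∃ x ∈ sobolev (ENNReal.ofReal p) Ω, x none =ᵐ[volume.restrict Ω] u := by
  constructor
  · rintro ⟨hu, hpartial⟩
    choose g hg hgLp using hpartial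
    refine ⟨WithLp.toLp _ fun o => o.elim (hu.toLp u) fun i => (hgLp i).toLp (g i),
      mem_sobolev.2 fun i => ?_, hu.coeFn_toLp⟩
    exact (hg i).congr hu.coeFn_toLp.symm (hgLp i).coeFn_toLp.symm
  · rintro ⟨x, hx, hxu⟩
    exact ⟨(Lp.memLp _).ae_eq hxu, fun i => ⟨x (some i), .of_mem_sobolev hx hxu i, Lp.memLp _⟩⟩

lemma enorm_eq_normPow_rpow (hΩ : IsOpen Ω) {x : Jet (ENNReal.ofReal p) Ω}
    (hx : x ∈ sobolev (ENNReal.ofReal p) Ω) (hxu : x none =ᵐ[volume.restrict Ω] u) :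
    ‖x‖ₑ = normPow p Ω u ^ p⁻¹ := by
  have hp : 0 < p := one_pos.trans_le (ENNReal.one_le_ofReal.1 Fact.out)
  have htoReal : (ENNReal.ofReal p).toReal = p := ENNReal.toReal_ofReal hp.le
  rw [← edist_zero_right, PiLp.edist_eq_sum (by rwa [htoReal]), Fintype.sum_option, htoReal,
    one_div, normPow]
  simp only [PiLp.zero_apply, edist_zero_right, Lp.enorm_def]
  rw [eLpNorm_congr_ae hxu]
  congr! 4 with i
  exact eLpNorm_congr_ae ((IsWeakPartial.of_mem_sobolev hx hxu i).weakPartial_ae_eq hΩ).symm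

lemma edist_eq_normPow_sub_rpow (hΩ : IsOpen Ω) {x y : Jet (ENNReal.ofReal p) Ω}
    (hx : x ∈ sobolev (ENNReal.ofReal p) Ω) (hy : y ∈ sobolev (ENNReal.ofReal p) Ω)
    (hxu : x none =ᵐ[volume.restrict Ω] u) (hyw : y none =ᵐ[volume.restrict Ω] w) :
    edist x y = normPow p Ω (fun z => u z - w z) ^ p⁻¹ := by
  rw [edist_eq_enorm_sub]
  exact enorm_eq_normPow_rpow hΩ (sub_mem hx hy) ((Lp.coeFn_sub _ _).trans (hxu.sub hyw))

lemma memWTilde_iff (hΩ : IsOpen Ω) :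
    MemWTilde p Ω u ↔
      ∃ x ∈ sobolevTilde (ENNReal.ofReal p) Ω, x none =ᵐ[volume.restrict Ω] u := by
  have hp : 0 < p := one_pos.trans_le (ENNReal.one_le_ofReal.1 Fact.out)
  constructor
  · rintro ⟨huW, happrox⟩
    obtain ⟨x, hx, hxu⟩ := memW_iff.1 huW
    refine ⟨x, EMetric.mem_closure_iff.2 fun ε hε => ?_, hxu⟩
    obtain ⟨w, hwcc, hwW, hlt⟩ := happrox (ε ^ p) (ENNReal.rpow_pos_of_nonneg hε hp.le)
    obtain ⟨y, hy, hyw⟩ := memW_iff.1 hwW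
    refine ⟨y, ⟨hy, w, hwcc, hyw⟩, ?_⟩
    rwa [edist_eq_normPow_sub_rpow hΩ hx hy hxu hyw, ENNReal.rpow_inv_lt_iff hp]
  · rintro ⟨x, hx, hxu⟩
    have hxW := sobolevTilde_le_sobolev hx
    refine ⟨memW_iff.2 ⟨x, hxW, hxu⟩, fun ε hε => ?_⟩
    obtain ⟨y, ⟨hy, w, hwcc, hyw⟩, hlt⟩ := EMetric.mem_closure_iff.1 hx (ε ^ p⁻¹)
      (ENNReal.rpow_pos_of_nonneg hε (inv_nonneg.2 hp.le))
    refine ⟨w, hwcc, memW_iff.2 ⟨y, hy, hyw⟩, ?_⟩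
    rwa [edist_eq_normPow_sub_rpow hΩ hxW hy hxu hyw,
      ENNReal.rpow_lt_rpow_iff (inv_pos.2 hp)] at hlt

lemma exists_memWTilde_hasSum (hΩ : IsOpen Ω) {v : ℕ → EuclideanSpace ℝ (Fin N) → ℝ}
    (hv : ∀ n, MemWTilde p Ω (v n)) (hsum : ∑' n, normPow p Ω (v n) ^ p⁻¹ ≠ ⊤) :
    ∃ w, MemWTilde p Ω w ∧ normPow p Ω w ^ p⁻¹ ≤ ∑' n, normPow p Ω (v n) ^ p⁻¹ ∧
      ∀ᵐ z ∂volume.restrict Ω, HasSum (fun n => v n z) (w z) := by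
  choose x hx hxv using fun n => (memWTilde_iff hΩ).1 (hv n)
  have hnorm (n) : ‖x n‖ₑ = normPow p Ω (v n) ^ p⁻¹ :=
    enorm_eq_normPow_rpow hΩ (sobolevTilde_le_sobolev (hx n)) (hxv n)
  simp only [← hnorm] at hsum ⊢
  have hsummable : Summable x := .of_enorm hsum
  have hmem : ∑' n, x n ∈ sobolevTilde (ENNReal.ofReal p) Ω :=
    isClosed_sobolevTilde.mem_of_tendsto hsummable.hasSum
      (.of_forall fun s => sum_mem fun n _ => hx n)
  have hcomponent : (∑' n, x n) none = ∑' n, x n none :=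
    (PiLp.proj (𝕜 := ℝ) _ _ none).map_tsum hsummable
  refine ⟨(∑' n, x n) none, (memWTilde_iff hΩ).2 ⟨_, hmem, .rfl⟩, ?_, ?_⟩
  · rw [← enorm_eq_normPow_rpow hΩ (sobolevTilde_le_sobolev hmem) .rfl]
    exact enorm_tsum_le_tsum_enorm
  · have hsum_none : ∑' n, ‖x n none‖ₑ ≠ ⊤ :=
      ne_top_of_le_ne_top hsum (ENNReal.tsum_le_tsum fun n => PiLp.enorm_apply_le _ _)
    rw [hcomponent]
    filter_upwards [Lp.hasSum_coeFn_tsum hsum_none, ae_all_iff.2 hxv] with z hz hzv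
    simpa only [hzv] using hz

lemma MemW.sub (hu : MemW p Ω u) (hw : MemW p Ω w) : MemW p Ω fun z => u z - w z := by
  obtain ⟨x, hx, hxu⟩ := memW_iff.1 hu
  obtain ⟨y, hy, hyw⟩ := memW_iff.1 hw
  exact memW_iff.2 ⟨x - y, sub_mem hx hy, (Lp.coeFn_sub _ _).trans (hxu.sub hyw)⟩

end MemW

section MulTestFunction

variable {N : ℕ} {p : ℝ} {U V : Set (EuclideanSpace ℝ (Fin N))}
  {u η : EuclideanSpace ℝ (Fin N) → ℝ}

lemma eLpNorm_le_normPow_rpow (hp : 0 < p) :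
    eLpNorm u (ENNReal.ofReal p) (volume.restrict U) ≤ normPow p U u ^ p⁻¹ := by
  rw [ENNReal.le_rpow_inv_iff hp]
  exact le_self_add

lemma eLpNorm_weakPartial_le_normPow_rpow (hp : 0 < p) (i : Fin N) :
    eLpNorm (weakPartial U i u) (ENNReal.ofReal p) (volume.restrict U) ≤ normPow p U u ^ p⁻¹ := by
  rw [ENNReal.le_rpow_inv_iff hp]
  exact (Finset.single_le_sum (f := fun j =>
    eLpNorm (weakPartial U j u) (ENNReal.ofReal p) (volume.restrict U) ^ p)
    (fun _ _ => zero_le) (Finset.mem_univ i)).trans le_add_self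

lemma MemW.isWeakPartial (hu : MemW p U u) (i : Fin N) :
    IsWeakPartial U i u (weakPartial U i u) := by
  obtain ⟨g, hg, -⟩ := hu.2 i
  have hex : ∃ g, IsWeakPartial U i u g := ⟨g, hg⟩
  rw [weakPartial, dif_pos hex]
  exact hex.choose_spec

lemma MemW.mul_testFunction (hU : IsOpen U) (hu : MemW p U u) (hη : IsTestFunction U η) :
    MemW p V fun x => u x * η x := by
  refine ⟨(hη.memLp_mul hU.measurableSet hu.1).restrict V, fun i => ?_⟩
  obtain ⟨g, hg, hgLp⟩ := hu.2 i
  exact ⟨_, hg.mul_testFunction hη, ((hη.memLp_mul hU.measurableSet hgLp).add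
    ((hη.fderiv_apply _).memLp_mul hU.measurableSet hu.1)).restrict V⟩

lemma eLpNorm_weakPartial_mul_testFunction_le (hp : 1 ≤ p) (hU : IsOpen U) (hV : IsOpen V)
    (hη : IsTestFunction U η) {i : Fin N} {B D : ℝ} (hB : ∀ x, ‖η x‖ ≤ B)
    (hD : ∀ x, ‖fderiv ℝ η x (EuclideanSpace.single i 1)‖ ≤ D) (hu : MemW p U u) :
    eLpNorm (weakPartial V i fun x => u x * η x) (ENNReal.ofReal p) (volume.restrict V) ≤
      (ENNReal.ofReal B + ENNReal.ofReal D) * normPow p U u ^ p⁻¹ := by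
  have hp' : 0 < p := one_pos.trans_le hp
  have hη' := hη.fderiv_apply (EuclideanSpace.single i 1)
  have hpartial := hu.isWeakPartial i
  set g := weakPartial U i u
  calc eLpNorm (weakPartial V i fun x => u x * η x) (ENNReal.ofReal p) (volume.restrict V)
    _ = eLpNorm (fun x => g x * η x + u x * fderiv ℝ η x (EuclideanSpace.single i 1))
          (ENNReal.ofReal p) (volume.restrict V) :=
        eLpNorm_congr_ae ((hpartial.mul_testFunction hη).weakPartial_ae_eq hV)
    _ ≤ eLpNorm (fun x => g x * η x + u x * fderiv ℝ η x (EuclideanSpace.single i 1))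
          (ENNReal.ofReal p) volume := eLpNorm_mono_measure _ Measure.restrict_le_self
    _ ≤ eLpNorm (fun x => g x * η x) (ENNReal.ofReal p) volume +
          eLpNorm (fun x => u x * fderiv ℝ η x (EuclideanSpace.single i 1))
            (ENNReal.ofReal p) volume :=
        eLpNorm_add_le (hη.integrable_mul hpartial.2.1).1 (hη'.integrable_mul hpartial.1).1
          (ENNReal.one_le_ofReal.2 hp)
    _ ≤ ENNReal.ofReal B * normPow p U u ^ p⁻¹ + ENNReal.ofReal D * normPow p U u ^ p⁻¹ :=
        add_le_add
          ((hη.eLpNorm_mul_le hU.measurableSet hB).trans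
            (by gcongr; exact eLpNorm_weakPartial_le_normPow_rpow hp' i))
          ((hη'.eLpNorm_mul_le hU.measurableSet hD).trans
            (by gcongr; exact eLpNorm_le_normPow_rpow hp'))
    _ = (ENNReal.ofReal B + ENNReal.ofReal D) * normPow p U u ^ p⁻¹ := (add_mul _ _ _).symm

lemma exists_normPow_mul_testFunction_le (hp : 1 ≤ p) (hU : IsOpen U) (hV : IsOpen V)
    (hη : IsTestFunction U η) :
    ∃ C : ℝ≥0∞, C ≠ ⊤ ∧ ∀ u, MemW p U u →
      normPow p V (fun x => u x * η x) ≤ C * normPow p U u := by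
  have hp' : 0 < p := one_pos.trans_le hp
  obtain ⟨B, hB⟩ := hη.exists_norm_le
  choose D hD using fun i => (hη.fderiv_apply (EuclideanSpace.single i 1)).exists_norm_le
  refine ⟨ENNReal.ofReal B ^ p + ∑ i, (ENNReal.ofReal B + ENNReal.ofReal (D i)) ^ p, ?_,
    fun u hu => ?_⟩
  · exact ENNReal.add_ne_top.2 ⟨by finiteness, ENNReal.sum_ne_top.2 fun i _ => by finiteness⟩
  have hpow {a b : ℝ≥0∞} (hab : a ≤ b * normPow p U u ^ p⁻¹) : a ^ p ≤ b ^ p * normPow p U u := by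
    calc a ^ p ≤ (b * normPow p U u ^ p⁻¹) ^ p := by gcongr
      _ = b ^ p * normPow p U u := by
        rw [ENNReal.mul_rpow_of_nonneg _ _ hp'.le, ENNReal.rpow_inv_rpow hp'.ne']
  rw [normPow, add_mul, Finset.sum_mul]
  refine add_le_add (hpow ?_) (Finset.sum_le_sum fun i _ =>
    hpow (eLpNorm_weakPartial_mul_testFunction_le hp hU hV hη hB (hD i) hu))
  calc eLpNorm (fun x => u x * η x) (ENNReal.ofReal p) (volume.restrict V)
    _ ≤ eLpNorm (fun x => u x * η x) (ENNReal.ofReal p) volume :=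
        eLpNorm_mono_measure _ Measure.restrict_le_self
    _ ≤ ENNReal.ofReal B * eLpNorm u (ENNReal.ofReal p) (volume.restrict U) :=
        hη.eLpNorm_mul_le hU.measurableSet hB
    _ ≤ ENNReal.ofReal B * normPow p U u ^ p⁻¹ := by
        gcongr
        exact eLpNorm_le_normPow_rpow hp'

lemma MemCc.mul_testFunction (hU : IsOpen U) (hu : MemCc U u) (hη : IsTestFunction U η) :
    MemCc V fun x => u x * η x := by
  have hcont : Continuous fun x => u x * η x :=
    ((hu.1.mono subset_closure).mul hη.continuous.continuousOn).continuous_of_tsupport_subset hU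
      (tsupport_mul_subset_right.trans hη.tsupport_subset)
  exact ⟨hcont.continuousOn, tsupport η ∩ closure V,
    hη.hasCompactSupport.inter_right isClosed_closure, Set.inter_subset_right, fun x hx =>
      mul_eq_zero_of_right _ (image_eq_zero_of_notMem_tsupport fun h => hx.2 ⟨h, hx.1⟩)⟩

lemma MemWTilde.mul_testFunction (hp : 1 ≤ p) (hU : IsOpen U) (hV : IsOpen V)
    (hu : MemWTilde p U u) (hη : IsTestFunction U η) : MemWTilde p V fun x => u x * η x := by
  have : Fact (1 ≤ ENNReal.ofReal p) := ⟨ENNReal.one_le_ofReal.2 hp⟩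
  refine ⟨hu.1.mul_testFunction hU hη, fun ε hε => ?_⟩
  obtain ⟨C, hC, hbound⟩ := exists_normPow_mul_testFunction_le hp hU hV hη
  obtain ⟨δ, hδ, hδε⟩ := ENNReal.exists_nnreal_pos_mul_lt hC hε.ne'
  obtain ⟨w, hwcc, hwW, hlt⟩ := hu.2 δ (mod_cast hδ)
  refine ⟨_, hwcc.mul_testFunction hU hη, hwW.mul_testFunction hU hη, ?_⟩
  simp only [← sub_mul]
  calc _ ≤ C * normPow p U fun x => u x - w x := hbound _ (hu.1.sub hwW)
    _ ≤ C * δ := by gcongr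
    _ < ε := by rwa [mul_comm]

end MulTestFunction

section Capacity

open Topology

variable {N : ℕ} {p : ℝ} {U V A : Set (EuclideanSpace ℝ (Fin N))}

lemma exists_admissible_normPow_mul_lt (hp : 1 ≤ p) (hU : IsOpen U) (hV : IsOpen V)
    {η : EuclideanSpace ℝ (Fin N) → ℝ} (hη : IsTestFunction U η) (hcap : relCap p U A = 0)
    {ε : ℝ≥0∞} (hε : 0 < ε) :
    ∃ u, Admissible p U A u ∧ normPow p V (fun x => u x * η x) < ε := by
  obtain ⟨C, hC, hbound⟩ := exists_normPow_mul_testFunction_le hp hU hV hη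
  obtain ⟨δ, hδ, hδε⟩ := ENNReal.exists_nnreal_pos_mul_lt hC hε.ne'
  obtain ⟨u, hu, hlt⟩ : ∃ u, ∃ _ : Admissible p U A u, normPow p U u < δ := by
    have hlt : relCap p U A < δ := hcap.trans_lt (ENNReal.coe_pos.2 hδ)
    simpa only [relCap, iInf_lt_iff] using hlt
  refine ⟨u, hu, ?_⟩
  calc _ ≤ C * normPow p U u := hbound u hu.1.1
    _ ≤ C * δ := by gcongr
    _ < ε := by rwa [mul_comm]

lemma exists_isOpen_ae_one_le_of_hasSum (hU : IsOpen U) (hAU : A ⊆ U)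
    {ψ u : ℕ → EuclideanSpace ℝ (Fin N) → ℝ} {w : EuclideanSpace ℝ (Fin N) → ℝ}
    (hψ : ∀ n x, 0 ≤ ψ n x)
    (hsum : ∀ x ∈ U, HasSum (fun n => ψ n x) 1 ∧ ∃ m, ∀ᶠ y in 𝓝 x, ∀ n > m, ψ n y = 0)
    (hu : ∀ n, Admissible p U A (u n))
    (hw : ∀ᵐ x ∂volume.restrict V, HasSum (fun n => u n x * ψ n x) (w x)) :
    ∃ G, IsOpen G ∧ A ⊆ G ∧ ∀ᵐ x ∂volume.restrict (G ∩ V), 1 ≤ w x := by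
  choose _ O hO hAO huO using hu
  let G := ⋃ m, U ∩ interior {x | ∀ n > m, ψ n x = 0} ∩ ⋂ n ∈ Set.Iic m, O n
  have hG : IsOpen G := isOpen_iUnion fun m =>
    (hU.inter isOpen_interior).inter ((Set.finite_Iic m).isOpen_biInter fun n _ => hO n)
  refine ⟨G, hG, fun x hx => ?_, ?_⟩
  · obtain ⟨-, m, hm⟩ := hsum x (hAU hx)
    exact Set.mem_iUnion.2 ⟨m, ⟨hAU hx, mem_interior_iff_mem_nhds.2 hm⟩,
      Set.mem_iInter₂.2 fun n _ => (hAO n hx).1⟩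
  · have hGV : ∀ᵐ x ∂volume.restrict (G ∩ V), x ∈ G :=
      ae_restrict_of_ae_restrict_of_subset Set.inter_subset_left (ae_restrict_mem hG.measurableSet)
    have hu_ae : ∀ᵐ x, ∀ n, x ∈ O n ∩ U → 1 ≤ u n x :=
      ae_all_iff.2 fun n => ae_imp_of_ae_restrict (huO n)
    filter_upwards [hGV, ae_restrict_of_ae hu_ae,
      ae_restrict_of_ae_restrict_of_subset Set.inter_subset_right hw] with x hxG hux hwx
    obtain ⟨m, ⟨hxU, hxm⟩, hxO⟩ := Set.mem_iUnion.1 hxG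
    refine hasSum_le (fun n => ?_) (hsum x hxU).1 hwx
    rcases le_or_gt n m with hn | hn
    · exact le_mul_of_one_le_left (hψ n x) (hux n ⟨Set.mem_iInter₂.1 hxO n hn, hxU⟩)
    · rw [interior_subset hxm n hn, mul_zero]

lemma relCap_eq_zero_of_subset_closure (hp : 1 ≤ p) (hU : IsOpen U) (hV : IsOpen V) (hAU : A ⊆ U)
    (hAV : A ⊆ closure V) (hcap : relCap p U A = 0) : relCap p V A = 0 := by
  have : Fact (1 ≤ ENNReal.ofReal p) := ⟨ENNReal.one_le_ofReal.2 hp⟩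
  have hp' : 0 < p := one_pos.trans_le hp
  obtain ⟨ψ, hψ, hψ0, hψsum⟩ := exists_isTestFunction_hasSum_one hU
  refine nonpos_iff_eq_zero.1 (le_of_forall_gt_imp_ge_of_dense fun ε hε => ?_)
  obtain ⟨δ, hδ, hδε⟩ := ENNReal.exists_pos_sum_of_countable'
    (ENNReal.rpow_pos_of_nonneg hε (inv_nonneg.2 hp'.le)).ne' ℕ
  choose u hu huδ using fun n => exists_admissible_normPow_mul_lt hp hU hV (hψ n) hcap
    (ENNReal.rpow_pos_of_nonneg (hδ n) hp'.le)
  have hle : ∑' n, normPow p V (fun x => u n x * ψ n x) ^ p⁻¹ ≤ ∑' n, δ n :=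
    ENNReal.tsum_le_tsum fun n => (ENNReal.rpow_inv_le_iff hp').2 (huδ n).le
  obtain ⟨w, hw, hwnorm, hwsum⟩ := exists_memWTilde_hasSum hV
    (fun n => (hu n).1.mul_testFunction hp hU hV (hψ n)) (hle.trans_lt hδε).ne_top
  obtain ⟨G, hG, hAG, hwG⟩ := exists_isOpen_ae_one_le_of_hasSum hU hAU hψ0 hψsum hu hwsum
  refine iInf₂_le_of_le w ⟨hw, G, hG, Set.subset_inter hAG hAV, hwG⟩ ?_
  exact (ENNReal.rpow_le_rpow_iff (inv_pos.2 hp')).1 (hwnorm.trans (hle.trans hδε.le))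

end Capacity

end RelCap

end

theorem mainTheorem9_general {N : ℕ} {p : ℝ} (hp : 1 ≤ p) {U V A : Set (EuclideanSpace ℝ (Fin N))}
    (hU : IsOpen U) (hV : IsOpen V) (hAU : A ⊆ U) (hAV : A ⊆ V) :
    RelCap.relCap p U A = 0 ↔ RelCap.relCap p V A = 0 :=
  ⟨RelCap.relCap_eq_zero_of_subset_closure hp hU hV hAU (hAV.trans subset_closure),
    RelCap.relCap_eq_zero_of_subset_closure hp hV hU hAV (hAU.trans subset_closure)⟩

theorem mainTheorem9 {N : ℕ} {p : ℝ} (hp : 1 < p) :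
    (∀ U V A : Set (EuclideanSpace ℝ (Fin N)), IsOpen U → IsOpen V → U.Nonempty → U ⊆ V → A ⊆ U →
      (RelCap.relCap p U A = 0 ↔ RelCap.relCap p V A = 0)) ∧
    (∀ U V A : Set (EuclideanSpace ℝ (Fin N)), IsOpen U → IsOpen V → U.Nonempty → V.Nonempty →
      A ⊆ U → A ⊆ V → (RelCap.relCap p U A = 0 ↔ RelCap.relCap p V A = 0)) :=
  ⟨fun _ _ _ hU hV _ hUV hAU => mainTheorem9_general hp.le hU hV hAU (hAU.trans hUV),
    fun _ _ _ hU hV _ _ hAU hAV => mainTheorem9_general hp.le hU hV hAU hAV⟩
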